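/- Let $H\in(0,\tfrac12)$, $x_0>0$, $a>0$, $\sigma>0$, and let $B^H=\{B^H(t),\ t\ge 0\}$ be a fractional Brownian motion with Hurst index $H$ on a probability space, i.e. a centered Gaussian process with covariance $\mathbb E[B^H(t)B^H(s)]=\frac12\left(t^{2H}+s^{2H}-|t-s|^{2H}\right)$, $s,t\ge0$, with almost surely continuous paths. For every $\varepsilon>0$ let $X^H_\varepsilon=\{X^H_\varepsilon(t),\ t\ge0\}$ be the (pathwise unique) continuous solution of \[ X^H_\varepsilon(t)=x_0+\int_0^t\frac{a}{X^H_\varepsilon(s)\mathbf 1_{\{X^H_\varepsilon(s)>0\}}+\varepsilon}\,ds+\sigma B^H(t),\qquad t\ge0 . \] Then, with probability $1$, the limits \[ X^H(t):=\lim_{\varepsilon\downarrow0}X^H_\varepsilon(t),\qquad L^H(t):=\lim_{\varepsilon\downarrow0}\int_0^t\frac{ds}{X^H_\varepsilon(s)\mathbf 1_{\{X^H_\varepsilon(s)>0\}}+\varepsilon} \] exist and are finite for all $t\ge0$ simultaneously, and, for these processes ($X^H$ being the rough Bessel process): (1) the function $t\mapsto L^H(t)$ is non-decreasing on $[0,\infty)$;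 (2) the functions $t\mapsto X^H(t)$ and $t\mapsto L^H(t)$ are continuous at every $t\ge0$. -/

import Mathlib

open Set Filter Topology MeasureTheory ProbabilityTheory
open scoped NNReal

namespace RoughBessel

variable {Ω : Type*} [MeasurableSpace Ω]

/-- Fractional Brownian motion with Hurst index `H`: a centered Gaussian process on `[0, ∞)` with
covariance `(t ^ (2H) + s ^ (2H) - |t - s| ^ (2H)) / 2` and, almost surely, continuous paths. -/
structure IsFractionalBrownianMotion (H : ℝ) (B : ℝ≥0 → Ω → ℝ) (P : Measure Ω) : Prop where
  gaussian : IsGaussianProcess B P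
  centered : ∀ t, ∫ ω, B t ω ∂P = 0
  covariance : ∀ s t : ℝ≥0, ∫ ω, B t ω * B s ω ∂P =
    (1 / 2) * ((t : ℝ) ^ (2 * H) + (s : ℝ) ^ (2 * H) - |(t : ℝ) - (s : ℝ)| ^ (2 * H))
  continuous_paths : ∀ᵐ ω ∂P, Continuous fun t ↦ B t ω

/-- The regularised reciprocal `1 / (x 1_{x > 0} + ε)`. -/
noncomputable def regInv (ε x : ℝ) : ℝ :=
  1 / (x * (Ioi (0 : ℝ)).indicator (fun _ ↦ (1 : ℝ)) x + ε)

/-- `∫_0^t ds / (x(s) 1_{x(s) > 0} + ε)` for a path `x` on `[0, ∞)`. -/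
noncomputable def regIntegral (ε : ℝ) (x : ℝ≥0 → ℝ) (t : ℝ≥0) : ℝ :=
  ∫ s in (0 : ℝ)..t, regInv ε (x s.toNNReal)

/-- The path `x` solves `x(t) = x₀ + ∫_0^t a / (x(s) 1_{x(s) > 0} + ε) ds + σ f(t)`, `t ≥ 0`. -/
structure IsPreLimitPath (x₀ a σ ε : ℝ) (f x : ℝ≥0 → ℝ) : Prop where
  continuous : Continuous x
  eq : ∀ t : ℝ≥0, x t = x₀ + a * regIntegral ε x t + σ * f t

section ExistsUnique

variable {x₀ a σ ε : ℝ} {f : ℝ≥0 → ℝ}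

theorem regInv_eq (ε x : ℝ) : regInv ε x = 1 / (max x 0 + ε) := by
  unfold regInv
  by_cases h : 0 < x
  · simp [h, h.le]
  · simp [h, not_lt.mp h]

theorem regInv_nonneg (hε : 0 < ε) (x : ℝ) : 0 ≤ regInv ε x := by
  rw [regInv_eq]; positivity

theorem regInv_le (hε : 0 < ε) (x : ℝ) : regInv ε x ≤ 1 / ε := by
  rw [regInv_eq]
  exact one_div_le_one_div_of_le hε (by linarith [le_max_right x 0])

theorem abs_regInv_sub_le (hε : 0 < ε) (x y : ℝ) :
    |regInv ε x - regInv ε y| ≤ 1 / ε ^ 2 * |x - y| := by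
  have hx : ε ≤ max x 0 + ε := by linarith [le_max_right x 0]
  have hy : ε ≤ max y 0 + ε := by linarith [le_max_right y 0]
  have hxy : |max y 0 - max x 0| ≤ |x - y| := by
    rw [abs_sub_comm x y]; exact abs_max_sub_max_le_abs y x 0
  rw [regInv_eq, regInv_eq, div_sub_div _ _ (by linarith) (by linarith), abs_div,
    one_mul, mul_one, abs_of_pos (mul_pos (hε.trans_le hx) (hε.trans_le hy)), one_div_mul_eq_div]
  have h2 : ε ^ 2 ≤ (max x 0 + ε) * (max y 0 + ε) := by nlinarith
  have h3 : |max y 0 + ε - (max x 0 + ε)| ≤ |x - y| := by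
    rwa [add_sub_add_right_eq_sub]
  gcongr

theorem continuous_regInv (hε : 0 < ε) : Continuous (regInv ε) := by
  have h : regInv ε = fun x ↦ 1 / (max x 0 + ε) := funext (regInv_eq ε)
  rw [h]
  refine Continuous.div (by fun_prop) (by fun_prop) fun x ↦ ?_
  have := le_max_right x 0
  linarith

/-- The vector field of the equation for `x - x₀ - σ f`. -/
noncomputable def field (x₀ a σ ε : ℝ) (f : ℝ≥0 → ℝ) (t y : ℝ) : ℝ :=
  a * regInv ε (x₀ + y + σ * f t.toNNReal)

theorem field_lipschitz (ha : 0 < a) (hε : 0 < ε) (t : ℝ) :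
    LipschitzWith (a / ε ^ 2).toNNReal (field x₀ a σ ε f t) := by
  refine LipschitzWith.of_dist_le_mul fun y z ↦ ?_
  rw [Real.coe_toNNReal _ (by positivity), Real.dist_eq, Real.dist_eq, field, field, ← mul_sub,
    abs_mul, abs_of_pos ha, div_eq_mul_one_div, mul_assoc]
  refine mul_le_mul_of_nonneg_left ?_ ha.le
  have h := abs_regInv_sub_le hε (x₀ + y + σ * f t.toNNReal) (x₀ + z + σ * f t.toNNReal)
  rwa [add_sub_add_right_eq_sub, add_sub_add_left_eq_sub] at h

theorem continuous_field (hε : 0 < ε) (hf : Continuous f) {z : ℝ → ℝ} (hz : Continuous z) :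
    Continuous fun t ↦ field x₀ a σ ε f t (z t) := by
  have := hf.comp continuous_real_toNNReal
  have h2 := continuous_regInv hε
  unfold field
  exact continuous_const.mul (h2.comp ((continuous_const.add hz).add (continuous_const.mul this)))

theorem eqOn_of_field (ha : 0 < a) (hε : 0 < ε) (hf : Continuous f) {T : ℝ} {z w : ℝ → ℝ}
    (hz : Continuous z) (hw : Continuous w)
    (hz' : ∀ t ∈ Icc 0 T, z t = ∫ s in (0 : ℝ)..t, field x₀ a σ ε f s (z s))
    (hw' : ∀ t ∈ Icc 0 T, w t = ∫ s in (0 : ℝ)..t, field x₀ a σ ε f s (w s)) :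
    EqOn z w (Icc 0 T) := by
  rcases lt_or_ge T 0 with hT | hT
  · simp [Icc_eq_empty_of_lt hT]
  have key : ∀ u : ℝ → ℝ, Continuous u →
      (∀ t ∈ Icc 0 T, u t = ∫ s in (0 : ℝ)..t, field x₀ a σ ε f s (u s)) →
      ∀ t ∈ Ico 0 T, HasDerivWithinAt u (field x₀ a σ ε f t (u t)) (Ici t) t := by
    intro u hu hu' t ht
    have h1 : HasDerivAt (fun r ↦ ∫ s in (0 : ℝ)..r, field x₀ a σ ε f s (u s))
        (field x₀ a σ ε f t (u t)) t :=
      ((continuous_field hε hf hu).integral_hasStrictDerivAt 0 t).hasDerivAt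
    refine h1.hasDerivWithinAt.congr_of_eventuallyEq ?_ (hu' t ⟨ht.1, ht.2.le⟩)
    filter_upwards [self_mem_nhdsWithin, mem_nhdsWithin_of_mem_nhds (Iio_mem_nhds ht.2)]
      with r hr hr'
    exact hu' r ⟨ht.1.trans hr, le_of_lt hr'⟩
  refine ODE_solution_unique_of_mem_Icc_right (v := field x₀ a σ ε f)
    (s := fun _ ↦ univ) (K := (a / ε ^ 2).toNNReal)
    (fun t _ ↦ (field_lipschitz ha hε t).lipschitzOnWith) hz.continuousOn (key z hz hz')
    (fun _ _ ↦ mem_univ _) hw.continuousOn (key w hw hw') (fun _ _ ↦ mem_univ _) ?_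
  rw [hz' 0 ⟨le_rfl, hT⟩, hw' 0 ⟨le_rfl, hT⟩]
  simp

theorem exists_field_Icc (ha : 0 < a) (hε : 0 < ε) (hf : Continuous f) (T : ℝ) (hT : 0 ≤ T) :
    ∃ z : ℝ → ℝ, Continuous z ∧
      ∀ t ∈ Icc 0 T, z t = ∫ s in (0 : ℝ)..t, field x₀ a σ ε f s (z s) := by
  have hPL : IsPicardLindelof (field x₀ a σ ε f) (tmin := 0) (tmax := T) ⟨0, le_rfl, hT⟩ 0
      (a / ε * T).toNNReal 0 (a / ε).toNNReal (a / ε ^ 2).toNNReal := by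
    constructor
    · exact fun t _ ↦ (field_lipschitz ha hε t).lipschitzOnWith
    · exact fun y _ ↦ (continuous_field hε hf continuous_const).continuousOn
    · intro t _ y _
      rw [Real.coe_toNNReal _ (by positivity), Real.norm_eq_abs, field, abs_mul, abs_of_pos ha,
        abs_of_nonneg (regInv_nonneg hε _), div_eq_mul_one_div]
      exact mul_le_mul_of_nonneg_left (regInv_le hε _) ha.le
    · rw [Real.coe_toNNReal _ (by positivity), Real.coe_toNNReal _ (by positivity)]
      simp [hT]
  obtain ⟨z, hz0, hz⟩ := hPL.exists_eq_forall_mem_Icc_hasDerivWithinAt₀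
  have hzc : ContinuousOn z (Icc 0 T) := fun t ht ↦ (hz t ht).continuousWithinAt
  refine ⟨fun t ↦ z (projIcc 0 T hT t), ?_, fun t ht ↦ ?_⟩
  · exact (continuousOn_iff_continuous_domRestrict.mp hzc).comp continuous_projIcc
  · have hcont : Continuous fun t ↦ z (projIcc 0 T hT t) :=
      (continuousOn_iff_continuous_domRestrict.mp hzc).comp continuous_projIcc
    have h1 : ∀ s ∈ Icc 0 T, z (projIcc 0 T hT s) = z s := fun s hs ↦ by
      rw [projIcc_of_mem hT hs]
    have hderiv : ∀ s ∈ Ioo 0 t, HasDerivAt (fun t ↦ z (projIcc 0 T hT t))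
        (field x₀ a σ ε f s (z (projIcc 0 T hT s))) s := by
      intro s hs
      have hs' : s ∈ Icc 0 T := ⟨hs.1.le, hs.2.le.trans ht.2⟩
      have hn : Icc 0 T ∈ 𝓝 s := Icc_mem_nhds hs.1 (hs.2.trans_le ht.2)
      rw [h1 s hs']
      refine ((hz s hs').hasDerivAt hn).congr_of_eventuallyEq ?_
      filter_upwards [hn] with r hr using h1 r hr
    have hFTC := intervalIntegral.integral_eq_sub_of_hasDerivAt_of_le ht.1
      hcont.continuousOn hderiv ((continuous_field hε hf hcont).intervalIntegrable 0 t)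
    rw [hFTC, h1 0 ⟨le_rfl, hT⟩]
    simp only at hz0
    rw [hz0, sub_zero]

theorem isPreLimitPath_iff {x : ℝ≥0 → ℝ} (hf : Continuous f) :
    IsPreLimitPath x₀ a σ ε f x ↔ ∃ z : ℝ → ℝ, Continuous z ∧
      (∀ t, 0 ≤ t → z t = ∫ s in (0 : ℝ)..t, field x₀ a σ ε f s (z s)) ∧
      ∀ t : ℝ≥0, x t = x₀ + z t + σ * f t := by
  constructor
  · intro h
    have hx : Continuous fun t : ℝ ↦ x t.toNNReal - x₀ - σ * f t.toNNReal :=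
      ((h.continuous.comp continuous_real_toNNReal).sub continuous_const).sub
        (continuous_const.mul (hf.comp continuous_real_toNNReal))
    refine ⟨_, hx, fun t ht ↦ ?_, fun t ↦ ?_⟩
    · have := h.eq t.toNNReal
      simp only [regIntegral, Real.coe_toNNReal t ht] at this
      rw [this, ← intervalIntegral.integral_const_mul]
      simp only [field]
      ring_nf
    · simp only [Real.toNNReal_coe]
      ring
  · rintro ⟨z, hz, hz', hx⟩
    refine ⟨?_, fun t ↦ ?_⟩
    · rw [funext hx]
      exact (continuous_const.add (hz.comp NNReal.continuous_coe)).add (continuous_const.mul hf)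
    · rw [hx, hz' t t.2, regIntegral, ← intervalIntegral.integral_const_mul]
      congr 2
      refine intervalIntegral.integral_congr fun s hs ↦ ?_
      rw [uIcc_of_le (NNReal.coe_nonneg t)] at hs
      simp only [field, hx, Real.coe_toNNReal s hs.1]

/-- The equation has exactly one solution for every continuous driving path. -/
theorem existsUnique_isPreLimitPath (ha : 0 < a) (hε : 0 < ε) (hf : Continuous f) :
    ∃! x, IsPreLimitPath x₀ a σ ε f x := by
  refine existsUnique_of_exists_of_unique ?_ ?_
  · choose z hz hz' using fun n : ℕ ↦
      exists_field_Icc (x₀ := x₀) (σ := σ) ha hε hf (n : ℝ) n.cast_nonneg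
    have hmono : ∀ m n : ℕ, m ≤ n → EqOn (z m) (z n) (Icc 0 (m : ℝ)) := fun m n hmn ↦
      eqOn_of_field ha hε hf (hz m) (hz n) (hz' m)
        fun t ht ↦ hz' n t ⟨ht.1, ht.2.trans (Nat.cast_le.mpr hmn)⟩
    let w : ℝ → ℝ := fun t ↦ z ⌈t⌉₊ (max t 0)
    have hw : ∀ n : ℕ, ∀ t ≤ (n : ℝ), w t = z n (max t 0) := fun n t ht ↦
      hmono _ n (Nat.ceil_le.mpr ht) ⟨le_max_right _ _, max_le (Nat.le_ceil t) (Nat.cast_nonneg _)⟩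
    refine ⟨fun t ↦ x₀ + w t + σ * f t, (isPreLimitPath_iff hf).mpr ⟨w, ?_, ?_, fun _ ↦ rfl⟩⟩
    · rw [continuous_iff_continuousAt]
      intro t
      obtain ⟨n, hn⟩ := exists_nat_gt t
      have hc : ContinuousAt (fun s ↦ z n (max s 0)) t :=
        ((hz n).comp (continuous_id.max continuous_const)).continuousAt
      refine hc.congr ?_
      filter_upwards [Iio_mem_nhds hn] with s hs using (hw n s (le_of_lt hs)).symm
    · intro t ht
      obtain ⟨n, hn⟩ := exists_nat_gt t
      rw [hw n t hn.le, max_eq_left ht, hz' n t ⟨ht, hn.le⟩]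
      refine intervalIntegral.integral_congr fun s hs ↦ ?_
      rw [uIcc_of_le ht] at hs
      simp only [hw n s (hs.2.trans hn.le), max_eq_left hs.1]
  · intro x y hx hy
    obtain ⟨z, hz, hz', hxz⟩ := (isPreLimitPath_iff hf).mp hx
    obtain ⟨w, hw, hw', hyw⟩ := (isPreLimitPath_iff hf).mp hy
    funext t
    rw [hxz, hyw, eqOn_of_field ha hε hf hz hw (fun s hs ↦ hz' s hs.1) (fun s hs ↦ hw' s hs.1)
      (⟨t.2, le_rfl⟩ : (t : ℝ) ∈ Icc 0 (t : ℝ))]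

end ExistsUnique

open scoped Classical in
/-- The solution path of the pre-limit equation driven by `f`; it exists and is unique when
`a, ε > 0` and `f` is continuous (and is set to `0` when there is no solution). -/
noncomputable def preLimitPath (x₀ a σ ε : ℝ) (f : ℝ≥0 → ℝ) : ℝ≥0 → ℝ :=
  if h : ∃ x, IsPreLimitPath x₀ a σ ε f x then h.choose else 0

theorem isPreLimitPath_preLimitPath {x₀ a σ ε : ℝ} {f : ℝ≥0 → ℝ} (ha : 0 < a) (hε : 0 < ε)
    (hf : Continuous f) : IsPreLimitPath x₀ a σ ε f (preLimitPath x₀ a σ ε f) := by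
  have h := (existsUnique_isPreLimitPath (x₀ := x₀) (σ := σ) ha hε hf).exists
  rw [preLimitPath, dif_pos h]
  exact h.choose_spec

/-- The pre-limit process `X_ε`, obtained by solving the equation path by path. -/
noncomputable def preLimitProcess (x₀ a σ : ℝ) (B : ℝ≥0 → Ω → ℝ) (ε : ℝ) (t : ℝ≥0) (ω : Ω) : ℝ :=
  preLimitPath x₀ a σ ε (fun s ↦ B s ω) t

/-- The integral `∫_0^t ds / (X_ε(s) 1_{X_ε(s) > 0} + ε)`. -/
noncomputable def preLimitDrift (x₀ a σ : ℝ) (B : ℝ≥0 → Ω → ℝ) (ε : ℝ) (t : ℝ≥0) (ω : Ω) : ℝ :=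
  regIntegral ε (fun s ↦ preLimitProcess x₀ a σ B ε s ω) t

/-- The rough Bessel process `X(t) = lim_{ε ↓ 0} X_ε(t)`. -/
noncomputable def besselProcess (x₀ a σ : ℝ) (B : ℝ≥0 → Ω → ℝ) (t : ℝ≥0) (ω : Ω) : ℝ :=
  limUnder (𝓝[>] (0 : ℝ)) fun ε ↦ preLimitProcess x₀ a σ B ε t ω

/-- The limit drift `L(t) = lim_{ε ↓ 0} ∫_0^t ds / (X_ε(s) 1_{X_ε(s) > 0} + ε)`. -/
noncomputable def driftProcess (x₀ a σ : ℝ) (B : ℝ≥0 → Ω → ℝ) (t : ℝ≥0) (ω : Ω) : ℝ :=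
  limUnder (𝓝[>] (0 : ℝ)) fun ε ↦ preLimitDrift x₀ a σ B ε t ω

end RoughBessel

/-!
The statement holds path by path: it only uses that almost every path `f` of `B` is continuous and
satisfies `f 0 = 0` (the variance of `B 0` is `0 ^ (2H) = 0`). No regularity of `f` beyond
continuity enters.

Fix such an `f` and write `x_ε` for the solution and `ℓ_ε` for its drift integral, so that
`x_ε = x₀ + a ℓ_ε + σ f`.

* Comparison (`IsPreLimitPath.antitone`): since `ε ↦ 1 / (x⁺ + ε)` and `x ↦ 1 / (x⁺ + ε)` are
  decreasing, `x_ε` increases as `ε` decreases.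
* Upper bound (`IsPreLimitPath.exists_le`): following the path from the last time it was below a
  level `η`, the drift is at most `a / η`, so
  `x_ε t ≤ max (x_ε s) η + a (t - s) / η + σ (f t - f u)` for some `u ∈ [s, t]`, uniformly in `ε`.

Together these give the limits `y` and `ℓ`, with `ℓ` monotone. As a supremum of continuous
functions, `y` is lower semicontinuous, hence so is `ℓ`, and a monotone lower semicontinuous
function is left-continuous. If `y t < 0`, then by left-continuity `y < 0` on an interval `(r, t]`,
so `x_ε < 0` there and `ℓ_ε t ≥ (t - r) / ε` is unbounded; hence `y ≥ 0`. Finally, letting `s → t⁺`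
and then `η → 0` in the upper bound gives `limsup_{s → t⁺} y s ≤ max (y t) 0 = y t`, which is the
missing half of right-continuity.
-/

namespace RoughBessel

/-! ### Estimates for a single pre-limit path -/

theorem regInv_le_of_le {ε ε' x x' : ℝ} (hε : 0 < ε) (h : ε ≤ ε') (hx : x ≤ x') :
    regInv ε' x' ≤ regInv ε x := by
  rw [regInv_eq, regInv_eq]
  have h0 := le_max_right x 0
  have h1 : max x 0 ≤ max x' 0 := max_le_max_right 0 hx
  exact one_div_le_one_div_of_le (by linarith) (by linarith)

theorem regInv_le_one_div {ε η x : ℝ} (hε : 0 < ε) (hη : 0 < η) (hx : η ≤ x) :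
    regInv ε x ≤ 1 / η := by
  rw [regInv_eq]
  exact one_div_le_one_div_of_le hη (by linarith [le_max_left x 0])

theorem regInv_of_nonpos {ε x : ℝ} (hx : x ≤ 0) : regInv ε x = 1 / ε := by
  rw [regInv_eq, max_eq_right hx, zero_add]

theorem intervalIntegrable_regInv {ε : ℝ} (hε : 0 < ε) {x : ℝ≥0 → ℝ} (hx : Continuous x)
    (s t : ℝ) : IntervalIntegrable (fun v : ℝ ↦ regInv ε (x v.toNNReal)) volume s t :=
  ((continuous_regInv hε).comp (hx.comp continuous_real_toNNReal)).intervalIntegrable s t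

theorem regIntegral_sub {ε : ℝ} (hε : 0 < ε) {x : ℝ≥0 → ℝ} (hx : Continuous x) (s t : ℝ≥0) :
    regIntegral ε x t - regIntegral ε x s = ∫ v in (s : ℝ)..t, regInv ε (x v.toNNReal) :=
  intervalIntegral.integral_interval_sub_left (intervalIntegrable_regInv hε hx _ _)
    (intervalIntegrable_regInv hε hx _ _)

theorem monotone_regIntegral {ε : ℝ} (hε : 0 < ε) {x : ℝ≥0 → ℝ} (hx : Continuous x) :
    Monotone (regIntegral ε x) := fun s t hst ↦ by
  rw [← sub_nonneg, regIntegral_sub hε hx]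
  exact intervalIntegral.integral_nonneg (NNReal.coe_le_coe.2 hst) fun v _ ↦ regInv_nonneg hε _

theorem toNNReal_mem_Ioo {s t : ℝ≥0} {v : ℝ} (hv : v ∈ Ioo (s : ℝ) t) :
    v.toNNReal ∈ Ioo s t := by
  have h := Real.coe_toNNReal v (s.2.trans hv.1.le)
  exact ⟨NNReal.coe_lt_coe.1 (hv.1.trans_eq h.symm), NNReal.coe_lt_coe.1 (h.trans_lt hv.2)⟩

/-- A continuous function on `[s, t]` stays above the level `c` after some time `u`, at which it is
at most `c` unless `u = s`. -/
theorem exists_forall_Ioc_lt {g : ℝ≥0 → ℝ} (hg : Continuous g) (c : ℝ) {s t : ℝ≥0} (hst : s ≤ t) :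
    ∃ u ∈ Icc s t, g u ≤ max (g s) c ∧ ∀ v ∈ Ioc u t, c < g v := by
  by_cases hne : (Icc s t ∩ {u | g u ≤ c}).Nonempty
  · obtain ⟨u, hu, hmax⟩ := (isCompact_Icc.inter_right
      (isClosed_le hg continuous_const)).exists_isGreatest hne
    refine ⟨u, hu.1, le_max_of_le_right hu.2, fun v hv ↦ ?_⟩
    by_contra! hvc
    exact (hmax ⟨⟨hu.1.1.trans hv.1.le, hv.2⟩, hvc⟩).not_gt hv.1
  · refine ⟨s, ⟨le_rfl, hst⟩, le_max_left _ _, fun v hv ↦ ?_⟩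
    by_contra! hvc
    exact hne ⟨v, ⟨hv.1.le, hv.2⟩, hvc⟩

namespace IsPreLimitPath

variable {x₀ a σ ε ε' : ℝ} {f x x' : ℝ≥0 → ℝ}

theorem sub_eq (h : IsPreLimitPath x₀ a σ ε f x) (hε : 0 < ε) (s t : ℝ≥0) :
    x t - x s = a * (∫ v in (s : ℝ)..t, regInv ε (x v.toNNReal)) + σ * (f t - f s) := by
  rw [← regIntegral_sub hε h.continuous, h.eq t, h.eq s]
  ring

/-- Comparison principle: a smaller regularisation parameter gives a larger solution. -/
theorem antitone (h : IsPreLimitPath x₀ a σ ε f x) (h' : IsPreLimitPath x₀ a σ ε' f x')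
    (ha : 0 < a) (hε : 0 < ε) (hεε' : ε ≤ ε') (t : ℝ≥0) : x' t ≤ x t := by
  have hε' := hε.trans_le hεε'
  obtain ⟨u, hu, hu0, hpos⟩ :=
    exists_forall_Ioc_lt (h'.continuous.sub h.continuous) 0 (zero_le (a := t))
  have h0 : x' 0 - x 0 = 0 := by simp [h.eq 0, h'.eq 0, regIntegral]
  simp only [Pi.sub_apply, h0, max_self] at hu0
  -- After `u` the path `x'` lies above `x`, so its drift is smaller.
  have hint : ∫ v in (u : ℝ)..t, regInv ε' (x' v.toNNReal) ≤
      ∫ v in (u : ℝ)..t, regInv ε (x v.toNNReal) := by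
    refine intervalIntegral.integral_mono_on_of_le_Ioo (NNReal.coe_le_coe.2 hu.2)
      (intervalIntegrable_regInv hε' h'.continuous _ _)
      (intervalIntegrable_regInv hε h.continuous _ _) fun v hv ↦ ?_
    have hv' := toNNReal_mem_Ioo hv
    exact regInv_le_of_le hε hεε' (sub_pos.1 (hpos _ ⟨hv'.1, hv'.2.le⟩)).le
  have h1 := h.sub_eq hε u t
  have h2 := h'.sub_eq hε' u t
  have h3 := mul_le_mul_of_nonneg_left hint ha.le
  linarith

/-- Upper bound uniform in `ε`: above the level `η` the drift is at most `a / η`. -/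
theorem exists_le (h : IsPreLimitPath x₀ a σ ε f x) (ha : 0 < a) (hε : 0 < ε) {η : ℝ}
    (hη : 0 < η) {s t : ℝ≥0} (hst : s ≤ t) :
    ∃ u ∈ Icc s t, x t ≤ max (x s) η + a * ((t - s) / η) + σ * (f t - f u) := by
  obtain ⟨u, hu, hux, hlt⟩ := exists_forall_Ioc_lt h.continuous η hst
  refine ⟨u, hu, ?_⟩
  have hint : ∫ v in (u : ℝ)..t, regInv ε (x v.toNNReal) ≤ ∫ _ in (u : ℝ)..t, 1 / η := by
    refine intervalIntegral.integral_mono_on_of_le_Ioo (NNReal.coe_le_coe.2 hu.2)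
      (intervalIntegrable_regInv hε h.continuous _ _) intervalIntegrable_const fun v hv ↦ ?_
    have hv' := toNNReal_mem_Ioo hv
    exact regInv_le_one_div hε hη (hlt _ ⟨hv'.1, hv'.2.le⟩).le
  rw [intervalIntegral.integral_const, smul_eq_mul, mul_one_div] at hint
  have hsu : ((t : ℝ) - u) / η ≤ (t - s) / η := by
    have := NNReal.coe_le_coe.2 hu.1
    gcongr
  have h1 := h.sub_eq hε u t
  have h2 := mul_le_mul_of_nonneg_left (hint.trans hsu) ha.le
  linarith

end IsPreLimitPath

/-! ### The limit along a fixed driving path -/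

section Limit

variable {x₀ a σ : ℝ} {f : ℝ≥0 → ℝ} {x : ℝ → ℝ≥0 → ℝ} {y ℓ : ℝ≥0 → ℝ}

theorem exists_tendsto_of_isPreLimitPath (ha : 0 < a) (hf : Continuous f)
    (hx : ∀ ε, 0 < ε → IsPreLimitPath x₀ a σ ε f (x ε)) (t : ℝ≥0) :
    ∃ c, Tendsto (fun ε ↦ x ε t) (𝓝[>] (0 : ℝ)) (𝓝 c) := by
  obtain ⟨C, hC⟩ := (isCompact_Icc (a := 0) (b := t)).bddAbove_image
    (f := fun u ↦ σ * (f t - f u)) (by fun_prop)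
  have hx0 : ∀ ε, 0 < ε → x ε 0 = x₀ + σ * f 0 := fun ε hε ↦ by
    simp [(hx ε hε).eq 0, regIntegral]
  have hbdd : BddAbove ((fun ε ↦ x ε t) '' Ioi 0) := by
    refine ⟨max (x₀ + σ * f 0) 1 + a * t + C, ?_⟩
    rintro _ ⟨ε, hε, rfl⟩
    obtain ⟨u, hu, h⟩ := (hx ε hε).exists_le ha hε one_pos (zero_le (a := t))
    have := hC ⟨u, hu, rfl⟩
    simp only [hx0 ε hε, NNReal.coe_zero, sub_zero, div_one] at h this
    linarith
  have hanti : AntitoneOn (fun ε ↦ x ε t) (Ioi 0) := fun ε hε ε' hε' h ↦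
    (hx ε hε).antitone (hx ε' hε') ha hε h t
  exact ⟨_, hanti.tendsto_nhdsGT hbdd⟩

theorem le_of_tendsto_of_isPreLimitPath (ha : 0 < a)
    (hx : ∀ ε, 0 < ε → IsPreLimitPath x₀ a σ ε f (x ε)) {t : ℝ≥0} {c : ℝ}
    (hy : Tendsto (fun ε ↦ x ε t) (𝓝[>] (0 : ℝ)) (𝓝 c)) {ε : ℝ} (hε : 0 < ε) : x ε t ≤ c := by
  refine ge_of_tendsto hy ?_
  filter_upwards [Ioo_mem_nhdsGT hε] with δ hδ
  exact (hx δ hδ.1).antitone (hx ε hε) ha hδ.1 hδ.2.le t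

theorem tendsto_regIntegral_of_tendsto (ha : 0 < a)
    (hx : ∀ ε, 0 < ε → IsPreLimitPath x₀ a σ ε f (x ε)) {t : ℝ≥0} {c : ℝ}
    (hy : Tendsto (fun ε ↦ x ε t) (𝓝[>] (0 : ℝ)) (𝓝 c)) :
    Tendsto (fun ε ↦ regIntegral ε (x ε) t) (𝓝[>] (0 : ℝ)) (𝓝 ((c - x₀ - σ * f t) / a)) := by
  refine (((hy.sub_const x₀).sub_const (σ * f t)).div_const a).congr' ?_
  filter_upwards [self_mem_nhdsWithin] with ε hε
  rw [(hx ε hε).eq t]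
  field_simp
  ring

theorem lowerSemicontinuous_of_tendsto (ha : 0 < a)
    (hx : ∀ ε, 0 < ε → IsPreLimitPath x₀ a σ ε f (x ε))
    (hy : ∀ t, Tendsto (fun ε ↦ x ε t) (𝓝[>] (0 : ℝ)) (𝓝 (y t))) : LowerSemicontinuous y := by
  intro t c hc
  obtain ⟨ε, hcε, hε⟩ := (((hy t).eventually (lt_mem_nhds hc)).and self_mem_nhdsWithin).exists
  filter_upwards [(hx ε hε).continuous.continuousAt.eventually (lt_mem_nhds hcε)] with s hs
  exact hs.trans_le (le_of_tendsto_of_isPreLimitPath ha hx (hy s) hε)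

/-- A monotone lower semicontinuous function is left-continuous. -/
theorem continuousWithinAt_Iic_of_monotone_of_lowerSemicontinuous {α : Type*} [TopologicalSpace α]
    [Preorder α] {g : α → ℝ} (hg : Monotone g) (hg' : LowerSemicontinuous g) (t : α) :
    ContinuousWithinAt g (Iic t) t := by
  refine tendsto_order.2 ⟨fun c hc ↦ mem_nhdsWithin_of_mem_nhds (hg' t c hc), fun c hc ↦ ?_⟩
  filter_upwards [self_mem_nhdsWithin] with s hs using (hg hs).trans_lt hc

/-- The limit path is nonnegative: the drift `1 / ε` below zero would otherwise accumulate to an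
infinite amount. -/
theorem nonneg_of_continuousWithinAt_Iic (ha : 0 < a) (h0 : 0 ≤ x₀ + σ * f 0)
    (hx : ∀ ε, 0 < ε → IsPreLimitPath x₀ a σ ε f (x ε))
    (hy : ∀ t, Tendsto (fun ε ↦ x ε t) (𝓝[>] (0 : ℝ)) (𝓝 (y t))) {t : ℝ≥0}
    (hyt : ContinuousWithinAt y (Iic t) t) : 0 ≤ y t := by
  by_contra! hneg
  rcases eq_zero_or_pos t with rfl | ht
  · have := le_of_tendsto_of_isPreLimitPath ha hx (hy 0) one_pos
    rw [(hx 1 one_pos).eq 0] at this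
    simp only [regIntegral, NNReal.coe_zero, intervalIntegral.integral_same] at this
    linarith
  obtain ⟨r, hrt, hr⟩ :=
    (mem_nhdsLE_iff_exists_Ioc_subset' ht).1 (hyt.eventually (gt_mem_nhds hneg))
  have hrt' : (r : ℝ) < t := NNReal.coe_lt_coe.2 hrt
  have hle : ∀ ε > 0, ((t : ℝ) - r) / ε ≤ (y t - x₀ - σ * f t) / a := by
    intro ε hε
    have hc := (hx ε hε).continuous
    have h1 : ∫ _ in (r : ℝ)..t, 1 / ε ≤ ∫ v in (r : ℝ)..t, regInv ε (x ε v.toNNReal) := by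
      refine intervalIntegral.integral_mono_on_of_le_Ioo hrt'.le intervalIntegrable_const
        (intervalIntegrable_regInv hε hc _ _) fun v hv ↦ ?_
      have hv' := toNNReal_mem_Ioo hv
      exact (regInv_of_nonpos ((le_of_tendsto_of_isPreLimitPath ha hx (hy _) hε).trans
        (le_of_lt (hr ⟨hv'.1, hv'.2.le⟩)))).ge
    rw [intervalIntegral.integral_const, smul_eq_mul, mul_one_div,
      ← regIntegral_sub hε hc] at h1
    have h2 : 0 ≤ regIntegral ε (x ε) r := by
      simpa [regIntegral] using monotone_regIntegral hε hc (zero_le (a := r))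
    have h3 := le_of_tendsto_of_isPreLimitPath ha hx (hy t) hε
    rw [(hx ε hε).eq t] at h3
    rw [le_div_iff₀ ha]
    nlinarith
  have hbound := hle 1 one_pos
  set K := (y t - x₀ - σ * f t) / a
  have hK : 0 < K := by rw [div_one] at hbound; linarith
  have h := hle (((t : ℝ) - r) / (2 * K)) (by have := sub_pos.2 hrt'; positivity)
  rw [div_div_cancel₀ (sub_pos.2 hrt').ne'] at h
  linarith

/-- Upper semicontinuity from the right at a time where the limit path is nonnegative. -/
theorem eventually_nhdsGE_lt (ha : 0 < a) (hf : Continuous f)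
    (hx : ∀ ε, 0 < ε → IsPreLimitPath x₀ a σ ε f (x ε))
    (hy : ∀ t, Tendsto (fun ε ↦ x ε t) (𝓝[>] (0 : ℝ)) (𝓝 (y t))) {t : ℝ≥0} (hyt : 0 ≤ y t)
    {c : ℝ} (hc : y t < c) : ∀ᶠ s in 𝓝[≥] t, y s < c := by
  -- The level `η` lies strictly between `y t ≥ 0` and `c`. For `s` close to `t` the drift term of
  -- the upper bound is at most `d` and the increment of `σ f` at most `2 d`, where `4 d = c - η`.
  obtain ⟨η, hη, hηc⟩ := exists_between hc
  have hη0 : 0 < η := hyt.trans_lt hη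
  set d := (c - η) / 4 with hd
  have hd0 : 0 < d := by linarith
  have hdrift : ∀ᶠ s : ℝ≥0 in 𝓝 t, a * (((s : ℝ) - t) / η) < d := by
    have : ContinuousAt (fun s : ℝ≥0 ↦ a * (((s : ℝ) - t) / η)) t := by fun_prop
    exact this.eventually (gt_mem_nhds (by simpa using hd0))
  have hosc : ∀ᶠ s : ℝ≥0 in 𝓝[≥] t, ∀ u ∈ Icc t s, |σ * f u - σ * f t| < d := by
    have : ContinuousAt (fun s ↦ σ * f s) t := by fun_prop
    have hev := (Metric.continuousAt_iff'.1 this d hd0)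
    obtain ⟨r, htr, hr⟩ := (mem_nhdsGE_iff_exists_Ico_subset).1 (mem_nhdsWithin_of_mem_nhds hev)
    filter_upwards [Ico_mem_nhdsGE htr] with s hs u hu
    exact hr ⟨hu.1, hu.2.trans_lt hs.2⟩
  filter_upwards [self_mem_nhdsWithin, mem_nhdsWithin_of_mem_nhds hdrift, hosc] with s hts h1 h2
  have hle : y s ≤ η + d + 2 * d := by
    refine le_of_tendsto (hy s) ?_
    filter_upwards [self_mem_nhdsWithin] with ε hε
    obtain ⟨u, hu, h⟩ := (hx ε hε).exists_le ha hε hη0 hts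
    have h3 := abs_lt.1 (h2 u hu)
    have h4 := abs_lt.1 (h2 s ⟨hts, le_rfl⟩)
    rw [max_eq_right ((le_of_tendsto_of_isPreLimitPath ha hx (hy t) hε).trans hη.le)] at h
    linarith
  linarith

/-- Continuity of the limit path `y`, and monotonicity and continuity of the limit drift `ℓ`, for
an arbitrary continuous driving path with `x₀ + σ f 0 ≥ 0`. -/
theorem continuous_of_tendsto (ha : 0 < a) (hf : Continuous f) (h0 : 0 ≤ x₀ + σ * f 0)
    (hx : ∀ ε, 0 < ε → IsPreLimitPath x₀ a σ ε f (x ε))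
    (hy : ∀ t, Tendsto (fun ε ↦ x ε t) (𝓝[>] (0 : ℝ)) (𝓝 (y t)))
    (hℓ : ∀ t, Tendsto (fun ε ↦ regIntegral ε (x ε) t) (𝓝[>] (0 : ℝ)) (𝓝 (ℓ t))) :
    Monotone ℓ ∧ Continuous y ∧ Continuous ℓ := by
  have hℓy : ℓ = fun t ↦ (y t - x₀ - σ * f t) / a := funext fun t ↦
    tendsto_nhds_unique (hℓ t) (tendsto_regIntegral_of_tendsto ha hx (hy t))
  have hyℓ : y = fun t ↦ a * ℓ t + (x₀ + σ * f t) := by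
    funext t
    rw [hℓy]
    field_simp
    ring
  have hmono : Monotone ℓ := fun s t hst ↦ by
    refine le_of_tendsto_of_tendsto (hℓ s) (hℓ t) ?_
    filter_upwards [self_mem_nhdsWithin] with ε hε
    exact monotone_regIntegral hε (hx ε hε).continuous hst
  have hlsc := lowerSemicontinuous_of_tendsto ha hx hy
  have hlscℓ : LowerSemicontinuous ℓ := by
    have hadd : LowerSemicontinuous fun t ↦ y t + (-x₀ - σ * f t) :=
      hlsc.add (Continuous.lowerSemicontinuous (by fun_prop))
    intro t c hc
    have : a * c < y t + (-x₀ - σ * f t) := by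
      rw [hyℓ]
      nlinarith
    filter_upwards [hadd t _ this] with s hs
    rw [hyℓ] at hs
    exact lt_of_mul_lt_mul_left (by linarith) ha.le
  have hleft : ∀ t, ContinuousWithinAt y (Iic t) t := fun t ↦ by
    rw [hyℓ]
    have h1 := continuousWithinAt_Iic_of_monotone_of_lowerSemicontinuous hmono hlscℓ t
    have h2 : Continuous fun t ↦ x₀ + σ * f t := by fun_prop
    exact (continuousWithinAt_const.mul h1).add h2.continuousWithinAt
  have hcont : Continuous y := continuous_iff_continuousAt.2 fun t ↦
    continuousAt_iff_continuous_left_right.2 ⟨hleft t, tendsto_order.2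
      ⟨fun c hc ↦ mem_nhdsWithin_of_mem_nhds (hlsc t c hc), fun _ hc ↦ eventually_nhdsGE_lt ha hf
        hx hy (nonneg_of_continuousWithinAt_Iic ha h0 hx hy (hleft t)) hc⟩⟩
  refine ⟨hmono, hcont, ?_⟩
  rw [hℓy]
  fun_prop

end Limit

/-! ### Fractional Brownian motion -/

theorem IsFractionalBrownianMotion.ae_eq_zero {Ω : Type*} [MeasurableSpace Ω] {P : Measure Ω}
    {H : ℝ} {B : ℝ≥0 → Ω → ℝ} (hB : IsFractionalBrownianMotion H B P) (hH : 0 < H) :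
    ∀ᵐ ω ∂P, B 0 ω = 0 := by
  have hint : ∫ ω, B 0 ω * B 0 ω ∂P = 0 := by
    rw [hB.covariance 0 0]
    simp [Real.zero_rpow (by linarith : 2 * H ≠ 0)]
  have hL2 := (hB.gaussian.hasGaussianLaw_eval 0).memLp_two
  rw [integral_eq_zero_iff_of_nonneg (fun ω ↦ mul_self_nonneg _) (hL2.integrable_mul hL2)] at hint
  filter_upwards [hint] with ω hω using mul_self_eq_zero.1 hω

end RoughBessel

theorem mainTheorem1 {Ω : Type*} [MeasurableSpace Ω] (P : Measure Ω) [IsProbabilityMeasure P]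
    (H x₀ a σ : ℝ) (hH : 0 < H) (hH' : H < 1 / 2) (hx₀ : 0 < x₀) (ha : 0 < a) (hσ : 0 < σ)
    (B : ℝ≥0 → Ω → ℝ) (hB : RoughBessel.IsFractionalBrownianMotion H B P) :
    ∀ᵐ ω ∂P,
      (∀ t : ℝ≥0, Tendsto (fun ε ↦ RoughBessel.preLimitProcess x₀ a σ B ε t ω) (𝓝[>] (0 : ℝ))
        (𝓝 (RoughBessel.besselProcess x₀ a σ B t ω))) ∧
      (∀ t : ℝ≥0, Tendsto (fun ε ↦ RoughBessel.preLimitDrift x₀ a σ B ε t ω) (𝓝[>] (0 : ℝ))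
        (𝓝 (RoughBessel.driftProcess x₀ a σ B t ω))) ∧
      (Monotone fun t : ℝ≥0 ↦ RoughBessel.driftProcess x₀ a σ B t ω) ∧
      (Continuous fun t : ℝ≥0 ↦ RoughBessel.besselProcess x₀ a σ B t ω) ∧
      (Continuous fun t : ℝ≥0 ↦ RoughBessel.driftProcess x₀ a σ B t ω) := by
  filter_upwards [hB.continuous_paths, hB.ae_eq_zero hH] with ω hf hf0
  have hx : ∀ ε, 0 < ε → RoughBessel.IsPreLimitPath x₀ a σ ε (fun s ↦ B s ω)
      (fun t ↦ RoughBessel.preLimitProcess x₀ a σ B ε t ω) :=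
    fun ε hε ↦ RoughBessel.isPreLimitPath_preLimitPath ha hε hf
  have hX : ∀ t : ℝ≥0, Tendsto (fun ε ↦ RoughBessel.preLimitProcess x₀ a σ B ε t ω)
      (𝓝[>] (0 : ℝ)) (𝓝 (RoughBessel.besselProcess x₀ a σ B t ω)) := fun t ↦
    tendsto_nhds_limUnder (RoughBessel.exists_tendsto_of_isPreLimitPath ha hf hx t)
  have hL : ∀ t : ℝ≥0, Tendsto (fun ε ↦ RoughBessel.preLimitDrift x₀ a σ B ε t ω)
      (𝓝[>] (0 : ℝ)) (𝓝 (RoughBessel.driftProcess x₀ a σ B t ω)) := fun t ↦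
    tendsto_nhds_limUnder ⟨_, RoughBessel.tendsto_regIntegral_of_tendsto ha hx (hX t)⟩
  exact ⟨hX, hL, RoughBessel.continuous_of_tendsto ha hf (by simp [hf0, hx₀.le]) hx hX hL⟩
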